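/- Let $\Omega=\mathbb{Z}\omega_1+\mathbb{Z}\omega_2$ be a lattice in $\mathbb{C}$ with elliptic invariants $g_2=60\sum_{0\ne l\in\Omega} l^{-4}$, $g_3=140\sum_{0\ne l\in\Omega} l^{-6}$ and Weierstrass functions $\wp$, \[ \zeta(z)=\frac1z+\sum_{0\ne l\in\Omega}\Big(\frac1{z-l}+\frac1l+\frac z{l^2}\Big),\qquad \sigma(z)=z\prod_{0\ne l\in\Omega}\Big(1-\frac zl\Big)\mathrm{e}^{\frac zl+\frac{z^2}{2l^2}} . \] For $\omega\in\Omega$ let $\eta=\eta(\omega)$ be the quasi-period, i.e. $\zeta(z+\omega)=\zeta(z)+\eta$ for all $z\in\mathbb{C}\setminus\Omega$, and let $\epsilon(\omega)=1$ if $\omega\in2\Omega$ and $\epsilon(\omega)=-1$ if $\omega\notin2\Omega$. For $n\ge1$ let $\psi_n(X,Y)\in\mathbb{Q}(g_2,g_3)[X,Y]$ be the $n$-th division polynomial of the curve $Y^2=4X^3-g_2X-g_3$, i.e. the standard $n$-th division polynomial of $y^2=x^3-\frac{g_2}4x-\frac{g_3}4$ with $x=X$, $y=Y/2$ (so $\psi_1=1$,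 $\psi_2=Y$, $\psi_3=3X^4-\frac32g_2X^2-3g_3X-\frac1{16}g_2^2$). Let $\omega\in\Omega$ and let $m\ge2$ be an integer such that $\frac{\omega}{m}\notin\Omega$. Then $\psi_{m+1}\big(\wp(\frac\omega m),\wp'(\frac\omega m)\big)\neq0$ and \[ \Big(\sigma\Big(\frac{\omega}{m}\Big)\,\mathrm{e}^{-\frac{\eta\omega}{2m^2}}\Big)^{m(m+2)}=\epsilon(\omega)\,(-1)^m\,\frac{1}{\psi_{m+1}\big(\wp(\frac{\omega}{m}),\wp'(\frac{\omega}{m})\big)} . \] In particular, the number $\sigma\big(\frac{\omega}{m}\big)\,\mathrm{e}^{-\frac{\eta\omega}{2m^2}}$ is algebraic over the field $\mathbb{Q}(g_2,g_3)$. -/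

import Mathlib

open Polynomial Module Filter
open scoped Topology Polynomial.Bivariate

noncomputable section

namespace PeriodPair

variable (L : PeriodPair)

/-- The Weierstrass zeta function
`ζ(z) = 1/z + ∑_{l ∈ Ω, l ≠ 0} (1/(z - l) + 1/l + z/l²)` of the lattice `Ω`. -/
def weierstrassZeta (z : ℂ) : ℂ :=
  1 / z + ∑' l : L.lattice, if (l : ℂ) = 0 then 0 else (1 / (z - l) + 1 / l + z / (l : ℂ) ^ 2)

/-- The Weierstrass sigma function
`σ(z) = z ∏_{l ∈ Ω, l ≠ 0} (1 - z/l) exp(z/l + z²/(2l²))` of the lattice `Ω`. -/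
def weierstrassSigma (z : ℂ) : ℂ :=
  z * ∏' l : L.lattice, if (l : ℂ) = 0 then 1 else
    (1 - z / l) * Complex.exp (z / l + z ^ 2 / (2 * (l : ℂ) ^ 2))

/-- The quasi-period `η(ω) = ζ(z + ω) - ζ(z)`. The value does not depend on `z ∉ Ω`, as shown in
`weierstrassZeta_add_period` below; here `z = ω₁/2` is used. -/
def quasiPeriod (ω : ℂ) : ℂ :=
  L.weierstrassZeta (L.ω₁ / 2 + ω) - L.weierstrassZeta (L.ω₁ / 2)

/-! The series of `ζ` and the product of `σ` converge, and `η` is well defined. -/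

theorem hasSumLocallyUniformly_weierstrassZeta :
    HasSumLocallyUniformly
      (fun (l : L.lattice) (z : ℂ) ↦
        if (l : ℂ) = 0 then 0 else (1 / (z - l) + 1 / l + z / (l : ℂ) ^ 2))
      (fun z ↦ ∑' l : L.lattice,
        if (l : ℂ) = 0 then 0 else (1 / (z - l) + 1 / l + z / (l : ℂ) ^ 2)) := by
  refine L.hasSumLocallyUniformly_aux (u := fun r l ↦ 2 * r ^ 2 * ‖l‖ ^ (-3 : ℝ)) _
    (fun _ _ ↦ (ZLattice.summable_norm_rpow _ _ (by simp; norm_num)).mul_left _) fun r hr ↦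
    Filter.eventually_atTop.mpr ⟨2 * r, ?_⟩
  rintro _ h s hs l rfl
  split_ifs with hl
  · simp only [norm_zero]
    positivity
  have hl' : 0 < ‖(l : ℂ)‖ := norm_pos_iff.mpr hl
  have hsl : s - l ≠ 0 := by
    intro e
    rw [sub_eq_zero] at e
    rw [← e] at h
    linarith
  have hlow : ‖(l : ℂ)‖ / 2 ≤ ‖s - l‖ := by
    have := norm_sub_norm_le (l : ℂ) s
    rw [norm_sub_rev] at this
    linarith
  have e : 1 / (s - l) + 1 / l + s / (l : ℂ) ^ 2 = s ^ 2 / ((l : ℂ) ^ 2 * (s - l)) := by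
    field_simp
    ring
  have e3 : ‖l‖ ^ (-3 : ℝ) = (‖(l : ℂ)‖ ^ 3)⁻¹ := by
    rw [Real.rpow_neg (norm_nonneg _)]
    norm_cast
  rw [e, e3, norm_div, norm_mul, norm_pow, norm_pow]
  calc ‖s‖ ^ 2 / (‖(l : ℂ)‖ ^ 2 * ‖s - l‖) ≤ r ^ 2 / (‖(l : ℂ)‖ ^ 2 * (‖(l : ℂ)‖ / 2)) := by gcongr
    _ = 2 * r ^ 2 * (‖(l : ℂ)‖ ^ 3)⁻¹ := by field_simp

theorem hasDerivAt_weierstrassZeta (z : ℂ) (hz : z ∉ L.lattice) :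
    HasDerivAt L.weierstrassZeta (-L.weierstrassP z) z := by
  have hopen : IsOpen ((L.lattice : Set ℂ)ᶜ) := L.isClosed_lattice.isOpen_compl
  have hterm : ∀ (l : L.lattice), ∀ x ∈ (L.lattice : Set ℂ)ᶜ, HasDerivAt
      (fun z : ℂ ↦ if (l : ℂ) = 0 then 0 else (1 / (z - l) + 1 / l + z / (l : ℂ) ^ 2))
      (-(if (l : ℂ) = 0 then 0 else (1 / (x - l) ^ 2 - 1 / (l : ℂ) ^ 2))) x := by
    intro l x hx
    split_ifs with hl
    · simpa using hasDerivAt_const x (0 : ℂ)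
    · have hxl : x - l ≠ 0 := by
        intro e
        rw [sub_eq_zero] at e
        exact hx (e ▸ l.2)
      have h1 := ((hasDerivAt_id x).sub_const (l : ℂ)).inv hxl
      have h2 := (h1.add_const (1 / (l : ℂ))).add ((hasDerivAt_id x).div_const ((l : ℂ) ^ 2))
      refine (h2.congr_deriv ?_).congr_of_eventuallyEq (.of_forall fun y ↦ ?_)
      · simp only [id]
        ring
      · simp
  have hloc := L.hasSumLocallyUniformly_weierstrassZeta.tendstoLocallyUniformlyOn
    (s := (L.lattice : Set ℂ)ᶜ)
  have hdiff : ∀ s : Finset L.lattice, DifferentiableOn ℂ (fun z ↦ ∑ l ∈ s,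
      if (l : ℂ) = 0 then 0 else (1 / (z - l) + 1 / l + z / (l : ℂ) ^ 2)) (L.lattice : Set ℂ)ᶜ :=
    fun s x hx ↦ (HasDerivAt.fun_sum fun l _ ↦ hterm l x hx).differentiableAt.differentiableWithinAt
  have hd := hloc.differentiableOn (.of_forall hdiff) hopen
  have hlim := (hloc.deriv (.of_forall hdiff) hopen).tendsto_at hz
  have hlim' := (L.hasSum_weierstrassPExcept 0 z).neg
  have hder := tendsto_nhds_unique hlim (hlim'.congr fun s ↦ by
    simp only [Function.comp_apply]
    exact (HasDerivAt.fun_sum fun l _ ↦ hterm l z hz).deriv.symm)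
  have hz0 : z ≠ 0 := by
    rintro rfl
    exact hz (zero_mem _)
  have h0 := (hd.differentiableAt (hopen.mem_nhds hz)).hasDerivAt
  rw [hder] at h0
  have h1 := (hasDerivAt_inv hz0).add h0
  have h2 := L.weierstrassPExcept_add 0 z
  simp only [Submodule.coe_zero, sub_zero] at h2
  refine (h1.congr_deriv ?_).congr_of_eventuallyEq (.of_forall fun y ↦ ?_)
  · rw [← h2]
    simp
  · simp [weierstrassZeta]

theorem weierstrassZeta_add_period (ω : ℂ) (hω : ω ∈ L.lattice) (z : ℂ) (hz : z ∉ L.lattice) :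
    L.weierstrassZeta (z + ω) = L.weierstrassZeta z + L.quasiPeriod ω := by
  have hadd : ∀ x ∈ (L.lattice : Set ℂ)ᶜ, x + ω ∉ L.lattice := fun x hx h ↦
    hx (by simpa using sub_mem h hω)
  have h1 : ∀ x ∈ (L.lattice : Set ℂ)ᶜ,
      HasDerivAt (fun x ↦ L.weierstrassZeta (x + ω)) (-L.weierstrassP x) x := by
    intro x hx
    have := (L.hasDerivAt_weierstrassZeta (x + ω) (hadd x hx)).comp_add_const x ω
    rwa [L.weierstrassP_add_coe x ⟨ω, hω⟩] at this
  have h2 : ∀ x ∈ (L.lattice : Set ℂ)ᶜ,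
      HasDerivAt (fun x ↦ L.weierstrassZeta x + L.quasiPeriod ω) (-L.weierstrassP x) x :=
    fun x hx ↦ (L.hasDerivAt_weierstrassZeta x hx).add_const _
  refine L.isClosed_lattice.isOpen_compl.eqOn_of_deriv_eq (𝕜 := ℂ)
    (f := fun x ↦ L.weierstrassZeta (x + ω)) (g := fun x ↦ L.weierstrassZeta x + L.quasiPeriod ω)
    ?_ (fun x hx ↦ (h1 x hx).differentiableAt.differentiableWithinAt)
    (fun x hx ↦ (h2 x hx).differentiableAt.differentiableWithinAt)
    (fun x hx ↦ (h1 x hx).deriv.trans (h2 x hx).deriv.symm)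
    (x := L.ω₁ / 2) L.ω₁_div_two_notMem_lattice ?_ hz
  · refine (Set.Countable.isConnected_compl_of_one_lt_rank (by simp) ?_).2
    exact countable_of_Lindelof_of_discrete (X := L.lattice)
  · simp [quasiPeriod]

theorem multipliable_weierstrassSigma (z : ℂ) :
    Multipliable fun l : L.lattice ↦ if (l : ℂ) = 0 then 1 else
      (1 - z / l) * Complex.exp (z / l + z ^ 2 / (2 * (l : ℂ) ^ 2)) := by
  have key : ∀ w : ℂ, ‖w‖ ≤ 1 / 2 →
      ‖(1 - w) * Complex.exp (w + w ^ 2 / 2) - 1‖ ≤ 10 * ‖w‖ ^ 3 := by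
    intro w hw
    have hv : ‖w + w ^ 2 / 2‖ ≤ 5 / 4 * ‖w‖ := by
      refine (norm_add_le _ _).trans ?_
      rw [norm_div, norm_pow, Complex.norm_ofNat]
      nlinarith [norm_nonneg w]
    have hR := Complex.exp_bound (x := w + w ^ 2 / 2) (by linarith) (n := 3) (by norm_num)
    set R := Complex.exp (w + w ^ 2 / 2) -
      ∑ k ∈ Finset.range 3, (w + w ^ 2 / 2) ^ k / (k.factorial : ℂ) with hRdef
    have e : (1 - w) * Complex.exp (w + w ^ 2 / 2) - 1 =
        w ^ 3 * (-1 / 2 - 3 / 8 * w - 1 / 8 * w ^ 2) + (1 - w) * R := by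
      rw [hRdef]
      simp only [Finset.sum_range_succ, Finset.sum_range_zero, Nat.factorial]
      push_cast
      ring
    have h1 : ‖-1 / 2 - 3 / 8 * w - 1 / 8 * w ^ 2‖ ≤ 1 := by
      refine (norm_sub_le _ _).trans ((add_le_add_left (norm_sub_le _ _) _).trans ?_)
      simp only [norm_div, norm_neg, norm_mul, norm_pow, norm_one, Complex.norm_ofNat]
      nlinarith [norm_nonneg w]
    have h2 : ‖1 - w‖ ≤ 2 := by
      refine (norm_sub_le _ _).trans ?_
      rw [norm_one]
      linarith
    have h3 : ‖R‖ ≤ ‖w‖ ^ 3 := by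
      refine hR.trans ?_
      calc _ ≤ (5 / 4 * ‖w‖) ^ 3 * (((Nat.succ 3 : ℕ) : ℝ) * ((Nat.factorial 3 : ℝ) * (3 : ℕ))⁻¹) := by
            gcongr
        _ = (125 / 288) * ‖w‖ ^ 3 := by
            norm_num [Nat.factorial]
            ring
        _ ≤ ‖w‖ ^ 3 := by nlinarith [pow_nonneg (norm_nonneg w) 3]
    rw [e]
    refine (norm_add_le _ _).trans ?_
    rw [norm_mul, norm_mul, norm_pow]
    have := mul_le_mul_of_nonneg_left h1 (pow_nonneg (norm_nonneg w) 3)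
    have := mul_le_mul h2 h3 (norm_nonneg _) (by norm_num)
    nlinarith [pow_nonneg (norm_nonneg w) 3]
  have hs : Summable fun l : L.lattice ↦ (if (l : ℂ) = 0 then 1 else
      (1 - z / l) * Complex.exp (z / l + z ^ 2 / (2 * (l : ℂ) ^ 2))) - 1 := by
    refine Summable.of_norm_bounded_eventually (g := fun l : L.lattice ↦
      10 * ‖z‖ ^ 3 * ‖l‖ ^ (-3 : ℝ))
      ((ZLattice.summable_norm_rpow _ _ (by simp; norm_num)).mul_left _) ?_
    have hfin : {l : L.lattice | ‖l‖ ≤ 2 * ‖z‖}.Finite := by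
      have := isCompact_iff_finite.mp (isCompact_closedBall (0 : L.lattice) (2 * ‖z‖))
      simpa [Metric.closedBall, dist_zero_right] using this
    filter_upwards [hfin.compl_mem_cofinite] with l hl
    have hl : 2 * ‖z‖ < ‖(l : ℂ)‖ := by simpa using hl
    have hl' : 0 < ‖(l : ℂ)‖ := lt_of_le_of_lt (by positivity) hl
    have e3 : ‖l‖ ^ (-3 : ℝ) = (‖(l : ℂ)‖ ^ 3)⁻¹ := by
      rw [Real.rpow_neg (norm_nonneg _)]
      norm_cast
    have := key (z / l) (by
      rw [norm_div, div_le_iff₀ hl']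
      linarith)
    rw [if_neg (norm_pos_iff.mp hl'), e3]
    convert this using 1
    · congr 4
      ring
    · rw [norm_div, div_pow]
      ring
  simpa using Complex.multipliable_one_add_of_summable hs

open scoped Classical in
/-- The sign `ε(ω)`: it is `1` if `ω ∈ 2Ω` and `-1` otherwise. -/
def periodSign (ω : ℂ) : ℂ := if ∃ l ∈ L.lattice, ω = 2 * l then 1 else -1

/-- The field `ℚ(g₂, g₃)`, as a subfield of `ℂ`. -/
abbrev invariantField : IntermediateField ℚ ℂ := IntermediateField.adjoin ℚ {L.g₂, L.g₃}

/-- `g₂` as an element of `ℚ(g₂, g₃)`. -/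
def g₂K : L.invariantField := ⟨L.g₂, IntermediateField.subset_adjoin ℚ _ (by simp)⟩

/-- `g₃` as an element of `ℚ(g₂, g₃)`. -/
def g₃K : L.invariantField := ⟨L.g₃, IntermediateField.subset_adjoin ℚ _ (by simp)⟩

/-- The curve `y² = x³ - (g₂/4) x - g₃/4` over `ℚ(g₂, g₃)`, whose points over `ℂ` are
parametrized by `x = ℘(z)`, `y = ℘'(z)/2`. -/
def curve : WeierstrassCurve L.invariantField where
  a₁ := 0
  a₂ := 0
  a₃ := 0
  a₄ := -L.g₂K / 4
  a₆ := -L.g₃K / 4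

/-- The division polynomial `ψ_m(X, Y) ∈ ℚ(g₂, g₃)[X, Y]` in the coordinates `X = ℘`, `Y = ℘'` of
the curve `Y² = 4X³ - g₂X - g₃`. It is obtained from the division polynomial of the curve
`y² = x³ - (g₂/4) x - g₃/4` by the substitution `y = Y/2`. -/
def divisionPoly (m : ℕ) : L.invariantField[X][Y] :=
  (L.curve.ψ m).comp (C (C (1 / 2)) * X)

end PeriodPair

end

/-! The key identity is ψ_n(℘(z), ℘'(z)) = (-1)^(n+1) σ(nz) / σ(z)^(n²) for z ∉ Ω (`evalPoint_ψ`).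
Take n = m + 1 and z = ω/m. Then nz = z + ω, and `weierstrassSigma_add_period` turns σ(nz) into ε(ω)
exp(η(z + ω/2)) σ(z). One factor σ(z) cancels, leaving σ(z)^(m(m+2)) in the denominator, and the
exponential is exactly what the normalizing factor exp(-ηω/(2m²)) contributes to that power.

The key identity rests on σ(u+v)σ(u-v) = σ(u)²σ(v)²(℘(v) - ℘(u)) (`weierstrassSigma_add_mul_sub`),
obtained from Liouville's theorem. Its limit v → u gives the duplication formulas, hence the cases n
≤ 4; applied to multiples of z it gives the recurrences that determine the division polynomials.

For algebraicity, ℘(ω/m) is a root of the nonzero univariate polynomial `ΨSq m`, because σ(m · ω/m)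
= 0. The differential equation then handles ℘'(ω/m). -/

noncomputable section

namespace PeriodPair

variable (L : PeriodPair)

/-! ### The sigma function -/

/-- The factor of the sigma product at the lattice point `l`. -/
def sigmaFactor (l : L.lattice) (z : ℂ) : ℂ :=
  if (l : ℂ) = 0 then 1 else (1 - z / l) * Complex.exp (z / l + z ^ 2 / (2 * (l : ℂ) ^ 2))

/-- The sigma function divided by `z`. -/
def sigmaProd (z : ℂ) : ℂ := ∏' l : L.lattice, L.sigmaFactor l z

lemma weierstrassSigma_eq (z : ℂ) : L.weierstrassSigma z = z * L.sigmaProd z := rfl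

/-- The exponent w + w²/2 cancels log(1 - w) through second order, so the deviation from 1 is cubic.
This matches the convergence of ∑ ‖l‖⁻³ over a planar lattice. -/
lemma norm_one_sub_mul_exp_sub_one_le {w : ℂ} (hw : ‖w‖ ≤ 1 / 2) :
    ‖(1 - w) * Complex.exp (w + w ^ 2 / 2) - 1‖ ≤ 10 * ‖w‖ ^ 3 := by
  have hv : ‖w + w ^ 2 / 2‖ ≤ 5 / 4 * ‖w‖ := by
    refine (norm_add_le _ _).trans ?_
    rw [norm_div, norm_pow, Complex.norm_ofNat]
    nlinarith [norm_nonneg w]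
  have hR := Complex.exp_bound (x := w + w ^ 2 / 2) (by linarith) (n := 3) (by norm_num)
  set R := Complex.exp (w + w ^ 2 / 2) -
    ∑ k ∈ Finset.range 3, (w + w ^ 2 / 2) ^ k / (k.factorial : ℂ) with hRdef
  have e : (1 - w) * Complex.exp (w + w ^ 2 / 2) - 1 =
      w ^ 3 * (-1 / 2 - 3 / 8 * w - 1 / 8 * w ^ 2) + (1 - w) * R := by
    rw [hRdef]
    simp only [Finset.sum_range_succ, Finset.sum_range_zero, Nat.factorial]
    push_cast
    ring
  have h1 : ‖-1 / 2 - 3 / 8 * w - 1 / 8 * w ^ 2‖ ≤ 1 := by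
    refine (norm_sub_le _ _).trans ((add_le_add_left (norm_sub_le _ _) _).trans ?_)
    simp only [norm_div, norm_neg, norm_mul, norm_pow, norm_one, Complex.norm_ofNat]
    nlinarith [norm_nonneg w]
  have h2 : ‖1 - w‖ ≤ 2 := by
    refine (norm_sub_le _ _).trans ?_
    rw [norm_one]
    linarith
  have h3 : ‖R‖ ≤ ‖w‖ ^ 3 := by
    refine hR.trans ?_
    calc _ ≤ (5 / 4 * ‖w‖) ^ 3 * (((Nat.succ 3 : ℕ) : ℝ) * ((Nat.factorial 3 : ℝ) * (3 : ℕ))⁻¹) := by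
          gcongr
      _ = (125 / 288) * ‖w‖ ^ 3 := by
          norm_num [Nat.factorial]
          ring
      _ ≤ ‖w‖ ^ 3 := by nlinarith [pow_nonneg (norm_nonneg w) 3]
  rw [e]
  refine (norm_add_le _ _).trans ?_
  rw [norm_mul, norm_mul, norm_pow]
  have := mul_le_mul_of_nonneg_left h1 (pow_nonneg (norm_nonneg w) 3)
  have := mul_le_mul h2 h3 (norm_nonneg _) (by norm_num)
  nlinarith [pow_nonneg (norm_nonneg w) 3]

lemma eventually_norm_sigmaFactor_sub_one_le (r : ℝ) (hr : 0 ≤ r) :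
    ∀ᶠ l : L.lattice in cofinite, ∀ z : ℂ, ‖z‖ ≤ r →
      ‖L.sigmaFactor l z - 1‖ ≤ 10 * r ^ 3 * ‖l‖ ^ (-3 : ℝ) := by
  -- Outside this finite set, ‖z‖ ≤ r forces ‖z/l‖ ≤ 1/2.
  have hfin : {l : L.lattice | ‖l‖ ≤ 2 * r}.Finite := by
    have := isCompact_iff_finite.mp (isCompact_closedBall (0 : L.lattice) (2 * r))
    simpa [Metric.closedBall, dist_zero_right] using this
  filter_upwards [hfin.compl_mem_cofinite] with l hl z hz
  have hl : 2 * r < ‖(l : ℂ)‖ := by simpa using hl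
  have hl' : 0 < ‖(l : ℂ)‖ := lt_of_le_of_lt (by positivity) hl
  have e3 : ‖l‖ ^ (-3 : ℝ) = (‖(l : ℂ)‖ ^ 3)⁻¹ := by
    rw [Real.rpow_neg (norm_nonneg _)]
    norm_cast
  have key := norm_one_sub_mul_exp_sub_one_le (w := z / l) (by
    rw [norm_div, div_le_iff₀ hl']
    linarith)
  rw [sigmaFactor, if_neg (norm_pos_iff.mp hl'), e3]
  have e : z / l + z ^ 2 / (2 * (l : ℂ) ^ 2) = z / l + (z / l) ^ 2 / 2 := by ring
  rw [e]
  refine key.trans ?_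
  rw [norm_div, div_pow, mul_assoc, div_eq_mul_inv]
  gcongr

lemma summable_sigmaBound (r : ℝ) :
    Summable fun l : L.lattice ↦ 10 * r ^ 3 * ‖l‖ ^ (-3 : ℝ) :=
  (ZLattice.summable_norm_rpow _ _ (by simp; norm_num)).mul_left _

lemma differentiable_sigmaFactor (l : L.lattice) : Differentiable ℂ (L.sigmaFactor l) := by
  unfold sigmaFactor
  split_ifs <;> fun_prop

lemma hasProdLocallyUniformlyOn_sigmaFactor :
    HasProdLocallyUniformlyOn L.sigmaFactor L.sigmaProd Set.univ := by
  refine hasProdLocallyUniformlyOn_of_forall_compact isOpen_univ fun K _ hK ↦ ?_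
  obtain ⟨r, hr0, hr⟩ := hK.isBounded.exists_pos_norm_le
  have := (L.summable_sigmaBound r).hasProdUniformlyOn_one_add
    (f := fun l z ↦ L.sigmaFactor l z - 1) hK
    ((L.eventually_norm_sigmaFactor_sub_one_le r hr0.le).mono fun l hl z hz ↦ hl z (hr z hz))
    fun l ↦ ((L.differentiable_sigmaFactor l).continuous.sub continuous_const).continuousOn
  simp only [add_sub_cancel] at this
  exact this

lemma differentiable_sigmaProd : Differentiable ℂ L.sigmaProd := by
  rw [← differentiableOn_univ]
  refine (hasProdLocallyUniformlyOn_iff_tendstoLocallyUniformlyOn.mp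
    L.hasProdLocallyUniformlyOn_sigmaFactor).differentiableOn (.of_forall fun s ↦ ?_) isOpen_univ
  exact (Differentiable.fun_finsetProd fun l _ ↦ L.differentiable_sigmaFactor l).differentiableOn

lemma differentiable_weierstrassSigma : Differentiable ℂ L.weierstrassSigma :=
  differentiable_id.mul L.differentiable_sigmaProd

lemma continuous_weierstrassSigma : Continuous L.weierstrassSigma :=
  L.differentiable_weierstrassSigma.continuous

lemma sigmaFactor_ne_zero {z : ℂ} (hz : z ∉ L.lattice) (l : L.lattice) :
    L.sigmaFactor l z ≠ 0 := by
  unfold sigmaFactor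
  split_ifs with h
  · exact one_ne_zero
  · refine mul_ne_zero (fun e ↦ hz ?_) (Complex.exp_ne_zero _)
    rw [sub_eq_zero, eq_comm, div_eq_one_iff_eq h] at e
    exact e ▸ l.2

lemma sigmaProd_ne_zero {z : ℂ} (hz : z ∉ L.lattice) : L.sigmaProd z ≠ 0 := by
  have := tprod_one_add_ne_zero_of_summable (f := fun l ↦ L.sigmaFactor l z - 1)
    (fun l ↦ by simpa using L.sigmaFactor_ne_zero hz l) ?_
  · simpa [sigmaProd] using this
  · exact Summable.of_norm_bounded_eventually (L.summable_sigmaBound ‖z‖)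
      ((L.eventually_norm_sigmaFactor_sub_one_le ‖z‖ (norm_nonneg _)).mono
        fun l hl ↦ by simpa using hl z le_rfl)

variable {L} in
lemma ne_zero_of_notMem_lattice {z : ℂ} (hz : z ∉ L.lattice) : z ≠ 0 := by
  rintro rfl
  exact hz (zero_mem _)

lemma weierstrassSigma_ne_zero {z : ℂ} (hz : z ∉ L.lattice) : L.weierstrassSigma z ≠ 0 :=
  mul_ne_zero (ne_zero_of_notMem_lattice hz) (L.sigmaProd_ne_zero hz)

@[simp]
lemma sigmaProd_zero : L.sigmaProd 0 = 1 := by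
  simp [sigmaProd, sigmaFactor]

@[simp]
lemma weierstrassSigma_zero : L.weierstrassSigma 0 = 0 := by
  simp [weierstrassSigma_eq]

lemma sigmaProd_neg (z : ℂ) : L.sigmaProd (-z) = L.sigmaProd z := by
  simp only [sigmaProd]
  rw [← (Equiv.neg L.lattice).tprod_eq]
  congr! 2 with l
  simp [sigmaFactor]

lemma weierstrassSigma_neg (z : ℂ) : L.weierstrassSigma (-z) = -L.weierstrassSigma z := by
  simp [weierstrassSigma_eq, sigmaProd_neg]

lemma weierstrassSigma_coe {l : ℂ} (hl : l ∈ L.lattice) : L.weierstrassSigma l = 0 := by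
  by_cases h : l = 0
  · simp [h]
  · rw [weierstrassSigma_eq, sigmaProd, tprod_of_exists_eq_zero, mul_zero]
    exact ⟨⟨l, hl⟩, by simp [sigmaFactor, h]⟩

lemma hasDerivAt_weierstrassSigma_zero : HasDerivAt L.weierstrassSigma 1 0 :=
  ((hasDerivAt_id (0 : ℂ)).mul (L.differentiable_sigmaProd 0).hasDerivAt).congr_deriv (by simp)

lemma logDeriv_sigmaFactor (l : L.lattice) {z : ℂ} (hz : z ∉ L.lattice) :
    logDeriv (L.sigmaFactor l) z =
      if (l : ℂ) = 0 then 0 else (1 / (z - l) + 1 / l + z / (l : ℂ) ^ 2) := by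
  by_cases h : (l : ℂ) = 0
  · have : L.sigmaFactor l = fun _ ↦ 1 := by
      ext
      simp [sigmaFactor, h]
    simp [this, h, logDeriv_const]
  · have e : L.sigmaFactor l = fun z ↦
        (1 - z / l) * Complex.exp (z / l + z ^ 2 / (2 * (l : ℂ) ^ 2)) := by
      ext
      simp [sigmaFactor, h]
    have hzl : z - l ≠ 0 := fun e ↦ hz (sub_eq_zero.mp e ▸ l.2)
    have hzl' : (l : ℂ) - z ≠ 0 := fun e ↦ hz (sub_eq_zero.mp e ▸ l.2)
    have h1 : HasDerivAt (fun z : ℂ ↦ 1 - z / l) (-(1 / l)) z :=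
      ((hasDerivAt_id z).div_const _).const_sub 1
    have h2 : HasDerivAt (fun z : ℂ ↦ z / l + z ^ 2 / (2 * (l : ℂ) ^ 2))
        (1 / l + z / (l : ℂ) ^ 2) z := by
      refine (((hasDerivAt_id z).div_const _).add
        ((hasDerivAt_pow 2 z).div_const _)).congr_deriv ?_
      simp
      ring
    rw [logDeriv_apply, e, (h1.fun_mul h2.cexp).deriv, if_neg h]
    have hE := Complex.exp_ne_zero (z / l + z ^ 2 / (2 * (l : ℂ) ^ 2))
    have h1z : 1 - z / l ≠ 0 := by
      rw [one_sub_div h]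
      exact div_ne_zero hzl' h
    have e2 : -(1 / (l : ℂ)) = 1 / (z - l) * (1 - z / l) := by
      field_simp
      ring
    rw [e2]
    field_simp
    ring

/-- Logarithmic differentiation of the locally uniformly convergent product, term by term, yields
the series of ζ. -/
lemma hasDerivAt_weierstrassSigma {z : ℂ} (hz : z ∉ L.lattice) :
    HasDerivAt L.weierstrassSigma (L.weierstrassZeta z * L.weierstrassSigma z) z := by
  have hs : logDeriv L.sigmaProd z = ∑' l, logDeriv (L.sigmaFactor l) z := by
    refine logDeriv_tprod_eq_tsum isOpen_univ (Set.mem_univ z) (L.sigmaFactor_ne_zero hz)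
      (fun l ↦ (L.differentiable_sigmaFactor l).differentiableOn) ?_
      L.hasProdLocallyUniformlyOn_sigmaFactor.multipliableLocallyUniformlyOn
      (L.sigmaProd_ne_zero hz)
    simp only [L.logDeriv_sigmaFactor _ hz]
    exact L.hasSumLocallyUniformly_weierstrassZeta.hasSum.summable
  simp only [L.logDeriv_sigmaFactor _ hz] at hs
  rw [logDeriv_apply, div_eq_iff (L.sigmaProd_ne_zero hz)] at hs
  have h0 := ne_zero_of_notMem_lattice hz
  refine ((hasDerivAt_id z).mul (L.differentiable_sigmaProd z).hasDerivAt).congr_deriv ?_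
  rw [hs, weierstrassSigma_eq, weierstrassZeta]
  simp only [id]
  field_simp

/-! ### Quasi-periodicity of σ -/

variable {L} in
lemma add_mem_lattice_iff {z ω : ℂ} (hω : ω ∈ L.lattice) : z + ω ∈ L.lattice ↔ z ∈ L.lattice :=
  ⟨fun h ↦ by simpa using sub_mem h hω, fun h ↦ add_mem h hω⟩

lemma isPreconnected_compl_lattice : IsPreconnected ((L.lattice : Set ℂ)ᶜ) := by
  refine (Set.Countable.isConnected_compl_of_one_lt_rank (by simp) ?_).2
  exact countable_of_Lindelof_of_discrete (X := L.lattice)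

/-- The logarithmic derivative of σ(z+ω)e^(-ηz)/σ(z) is ζ(z+ω) - η - ζ(z) = 0, and the complement of
Ω is connected, so this quotient is a constant c. Oddness of σ gives c². -/
lemma exists_weierstrassSigma_add_period {ω : ℂ} (hω : ω ∈ L.lattice) :
    ∃ c : ℂ, c ^ 2 = Complex.exp (L.quasiPeriod ω * ω) ∧ ∀ z,
      L.weierstrassSigma (z + ω) = c * Complex.exp (L.quasiPeriod ω * z) * L.weierstrassSigma z := by
  set η := L.quasiPeriod ω
  set f : ℂ → ℂ := fun z ↦
    L.weierstrassSigma (z + ω) * Complex.exp (-(η * z)) / L.weierstrassSigma z with hf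
  have hd : ∀ z ∈ (L.lattice : Set ℂ)ᶜ, HasDerivAt f 0 z := by
    intro z hz
    have hs := L.weierstrassSigma_ne_zero hz
    have h1 := (L.hasDerivAt_weierstrassSigma
      ((add_mem_lattice_iff hω).not.mpr hz)).comp_add_const z ω
    have h2 := ((hasDerivAt_id z).const_mul η).fun_neg.cexp
    refine ((h1.fun_mul h2).fun_div (L.hasDerivAt_weierstrassSigma hz) hs).congr_deriv ?_
    rw [L.weierstrassZeta_add_period ω hω z hz]
    simp only [id]
    ring
  have hc : ∀ z ∈ (L.lattice : Set ℂ)ᶜ, f z = f (L.ω₁ / 2) := by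
    refine L.isClosed_lattice.isOpen_compl.eqOn_of_deriv_eq (𝕜 := ℂ) (f := f)
      (g := fun _ ↦ f (L.ω₁ / 2)) L.isPreconnected_compl_lattice
      (fun x hx ↦ (hd x hx).differentiableAt.differentiableWithinAt) (by fun_prop)
      (fun x hx ↦ by simp [(hd x hx).deriv]) (x := L.ω₁ / 2) L.ω₁_div_two_notMem_lattice rfl
  have key : ∀ z, L.weierstrassSigma (z + ω) =
      f (L.ω₁ / 2) * Complex.exp (η * z) * L.weierstrassSigma z := by
    intro z
    by_cases hz : z ∈ L.lattice
    · rw [L.weierstrassSigma_coe hz, L.weierstrassSigma_coe (add_mem hz hω), mul_zero]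
    · rw [← hc z hz, hf]
      have := L.weierstrassSigma_ne_zero hz
      have := Complex.exp_ne_zero (η * z)
      simp only [Complex.exp_neg]
      field_simp
  refine ⟨_, ?_, key⟩
  have hs := L.weierstrassSigma_ne_zero L.ω₁_div_two_notMem_lattice
  have h1 := key (L.ω₁ / 2)
  -- The reflection z ↦ -z - ω exchanges z and z + ω up to sign, so oddness yields a second relation
  -- for the constant.
  have h2 := key (-(L.ω₁ / 2) - ω)
  rw [sub_add_cancel, ← neg_add', weierstrassSigma_neg, weierstrassSigma_neg, h1] at h2
  have e : η * -(L.ω₁ / 2 + ω) = -(η * (L.ω₁ / 2)) + -(η * ω) := by ring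
  rw [e, Complex.exp_add, Complex.exp_neg, Complex.exp_neg] at h2
  have h3 := Complex.exp_ne_zero (η * (L.ω₁ / 2))
  have h4 := Complex.exp_ne_zero (η * ω)
  field_simp at h2
  exact (neg_injective h2).symm

/-- Only the sign of c is left to find. If ω = 2l, translating twice by l gives it from the square
of the constant for l. Otherwise σ(-ω/2) ≠ 0, and evaluation at -ω/2 together with oddness forces
the minus sign. -/
lemma weierstrassSigma_add_period {ω : ℂ} (hω : ω ∈ L.lattice) (z : ℂ) :
    L.weierstrassSigma (z + ω) =
      L.periodSign ω * Complex.exp (L.quasiPeriod ω * (z + ω / 2)) * L.weierstrassSigma z := by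
  have hexp : Complex.exp (L.quasiPeriod ω * (z + ω / 2)) =
      Complex.exp (L.quasiPeriod ω * ω / 2) * Complex.exp (L.quasiPeriod ω * z) := by
    rw [← Complex.exp_add]
    ring_nf
  rw [hexp, ← mul_assoc]
  obtain ⟨c, -, hc⟩ := L.exists_weierstrassSigma_add_period hω
  suffices c = L.periodSign ω * Complex.exp (L.quasiPeriod ω * ω / 2) by rw [hc, this]
  unfold periodSign
  split_ifs with h
  · obtain ⟨l, hl, rfl⟩ := h
    obtain ⟨d, hd2, hd⟩ := L.exists_weierstrassSigma_add_period hl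
    have hη : L.quasiPeriod (2 * l) = 2 * L.quasiPeriod l := by
      have hz := L.ω₁_div_two_notMem_lattice
      have h1 := L.weierstrassZeta_add_period l hl _ hz
      have h2 := L.weierstrassZeta_add_period l hl _ ((add_mem_lattice_iff hl).not.mpr hz)
      rw [h1] at h2
      rw [quasiPeriod, two_mul, ← add_assoc, h2]
      ring
    have hs := L.weierstrassSigma_ne_zero L.ω₁_div_two_notMem_lattice
    have h1 := hc (L.ω₁ / 2)
    rw [two_mul l, ← add_assoc, hd, hd, ← two_mul l, hη, mul_add, Complex.exp_add] at h1
    rw [hη]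
    have e1 : 2 * L.quasiPeriod l * (L.ω₁ / 2) =
      L.quasiPeriod l * (L.ω₁ / 2) + L.quasiPeriod l * (L.ω₁ / 2) := by ring
    have e2 : 2 * L.quasiPeriod l * (2 * l) / 2 = L.quasiPeriod l * l + L.quasiPeriod l * l := by
      ring
    rw [e1, Complex.exp_add] at h1
    rw [e2, Complex.exp_add]
    have h3 := Complex.exp_ne_zero (L.quasiPeriod l * (L.ω₁ / 2))
    rw [← hd2] at h1 ⊢
    refine mul_right_cancel₀ (mul_ne_zero (mul_ne_zero h3 h3) hs) ?_
    linear_combination -h1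
  · have h2 : -(ω / 2) ∉ L.lattice := fun h' ↦ h ⟨ω / 2, by simpa using neg_mem h', by ring⟩
    have h1 := hc (-(ω / 2))
    have hs := L.weierstrassSigma_ne_zero h2
    have e : -(ω / 2) + ω = -(-(ω / 2)) := by ring
    have e3 : L.quasiPeriod ω * -(ω / 2) = -(L.quasiPeriod ω * ω / 2) := by ring
    rw [e, weierstrassSigma_neg, e3, Complex.exp_neg] at h1
    have h3 := Complex.exp_ne_zero (L.quasiPeriod ω * ω / 2)
    rw [← div_eq_mul_inv] at h1
    rw [neg_one_mul, ← mul_left_inj' hs, ← neg_inj]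
    have h4 : L.weierstrassSigma (-(ω / 2)) = c / Complex.exp (L.quasiPeriod ω * ω / 2) *
      -L.weierstrassSigma (-(ω / 2)) := by linear_combination -h1
    rw [div_mul_eq_mul_div, eq_div_iff h3] at h4
    linear_combination -h4

/-! ### The product formula for σ(u+v)σ(u-v) -/

/-- An analytic even function that vanishes at the origin vanishes there to second order. -/
lemma exists_analyticAt_eq_sq_mul {N : ℂ → ℂ} (hN : AnalyticAt ℂ N 0) (heven : ∀ u, N (-u) = N u)
    (h0 : N 0 = 0) : ∃ G : ℂ → ℂ, AnalyticAt ℂ G 0 ∧ ∀ u, N u = u ^ 2 * G u := by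
  have hds : ∀ {f : ℂ → ℂ}, AnalyticAt ℂ f 0 → AnalyticAt ℂ (dslope f 0) 0 :=
    fun ⟨p, hp⟩ ↦ ⟨_, hp.has_fpower_series_dslope_fslope⟩
  refine ⟨dslope (dslope N 0) 0, hds (hds hN), fun u ↦ ?_⟩
  have hder : deriv N 0 = 0 := by
    have h1 : (fun u ↦ N (-u)) = N := funext heven
    have h2 := deriv_comp_neg N 0
    rw [h1, neg_zero] at h2
    linear_combination h2 / 2
  have h1 := sub_smul_dslope N 0 u
  have h2 := sub_smul_dslope (dslope N 0) 0 u
  rw [dslope_same, hder] at h2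
  simp only [h0, sub_zero, smul_eq_mul] at h1 h2
  rw [← h1, ← h2]
  ring

/-- A function that is differentiable off a lattice, extends analytically over the origin and is
periodic, is constant off the lattice. -/
lemma eq_of_periodic_of_removable {q G : ℂ → ℂ} (hq : ∀ u ∉ L.lattice, DifferentiableAt ℂ q u)
    (hper : ∀ l ∈ L.lattice, ∀ u ∉ L.lattice, q (u + l) = q u) (hG : AnalyticAt ℂ G 0)
    (hqG : ∀ᶠ u in 𝓝[≠] 0, q u = G u) {u v : ℂ} (hu : u ∉ L.lattice) (hv : v ∉ L.lattice) :
    q u = q v := by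
  classical
  set Q : ℂ → ℂ := fun u ↦ if u ∈ L.lattice then G 0 else q u with hQ
  have hQper : ∀ u l, l ∈ L.lattice → Q (u + l) = Q u := by
    intro u l hl
    simp only [hQ, add_mem_lattice_iff hl]
    split_ifs with h
    · rfl
    · exact hper l hl u h
  have hQ0 : DifferentiableAt ℂ Q 0 := by
    refine hG.differentiableAt.congr_of_eventuallyEq ?_
    filter_upwards [L.compl_lattice_sdiff_singleton_mem_nhds 0,
      eventually_nhdsWithin_iff.mp hqG] with u hu1 hu2
    by_cases h : u = 0
    · simp [hQ, h]
    · have : u ∉ L.lattice := fun h' ↦ hu1 ⟨h', h⟩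
      simp only [hQ, if_neg this]
      exact hu2 h
  have hdiff : Differentiable ℂ Q := by
    intro x
    by_cases hx : x ∈ L.lattice
    · have e : Q = fun u ↦ Q (u - x) := by
        ext u
        simpa using hQper (u - x) x hx
      rw [e]
      refine DifferentiableAt.fun_comp' x (f := fun u ↦ u - x) (by simpa using hQ0) (by fun_prop)
    · refine (hq x hx).congr_of_eventuallyEq ?_
      filter_upwards [L.isClosed_lattice.isOpen_compl.mem_nhds hx] with y hy
      exact if_neg hy
  -- The extension is entire and periodic, hence bounded, and Liouville's theorem applies.
  have := hdiff.apply_eq_apply_of_bounded (IsZLattice.isCompact_range_of_periodic L.lattice _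
    hdiff.continuous hQper).isBounded u v
  simpa only [hQ, if_neg hu, if_neg hv] using this

lemma analyticAt_weierstrassSigma (z : ℂ) : AnalyticAt ℂ L.weierstrassSigma z :=
  L.differentiable_weierstrassSigma.analyticAt z

/-- For fixed v, divide by σ(u)² and take the difference of the two sides. This function of u is
elliptic, its singularity at the origin is removable, and it vanishes at u = v. -/
lemma weierstrassSigma_add_mul_sub {u v : ℂ} (hu : u ∉ L.lattice) (hv : v ∉ L.lattice) :
    L.weierstrassSigma (u + v) * L.weierstrassSigma (u - v) =
      L.weierstrassSigma u ^ 2 * L.weierstrassSigma v ^ 2 *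
        (L.weierstrassP v - L.weierstrassP u) := by
  set q : ℂ → ℂ := fun u ↦
    L.weierstrassSigma (u + v) * L.weierstrassSigma (u - v) / L.weierstrassSigma u ^ 2 +
      L.weierstrassSigma v ^ 2 * (L.weierstrassP u - L.weierstrassP v) with hq
  -- N(u) is u² `sigmaProd`(u)² q(u), with ℘(u) written as u⁻² plus its regular part. Being even
  -- with N(0) = 0, it absorbs the factor u².
  set N : ℂ → ℂ := fun u ↦ L.weierstrassSigma (u + v) * L.weierstrassSigma (u - v) +
    L.sigmaProd u ^ 2 * L.weierstrassSigma v ^ 2 *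
      (1 + u ^ 2 * (L.weierstrassPExcept 0 u - L.weierstrassP v)) with hN
  have hNan : AnalyticAt ℂ N 0 := by
    have h1 : AnalyticAt ℂ (fun u ↦ L.weierstrassSigma (u + v)) 0 :=
      (L.analyticAt_weierstrassSigma _).fun_comp (by fun_prop)
    have h2 : AnalyticAt ℂ (fun u ↦ L.weierstrassSigma (u - v)) 0 :=
      (L.analyticAt_weierstrassSigma _).fun_comp (by fun_prop)
    have h3 := L.differentiable_sigmaProd.analyticAt 0
    have h4 := L.analyticAt_weierstrassPExcept 0
    fun_prop
  have hNeven : ∀ u, N (-u) = N u := by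
    intro u
    have e1 : -u + v = -(u - v) := by ring
    have e2 : -u - v = -(u + v) := by ring
    simp only [hN, sigmaProd_neg, weierstrassPExcept_neg, neg_zero, e1, e2, weierstrassSigma_neg]
    ring
  have hN0 : N 0 = 0 := by
    simp [hN, weierstrassSigma_neg]
    ring
  obtain ⟨G, hG, hNG⟩ := exists_analyticAt_eq_sq_mul hNan hNeven hN0
  have hqv : q v = 0 := by simp [hq]
  have hquv : q u = q v := by
    refine L.eq_of_periodic_of_removable (q := q) (G := fun u ↦ G u / L.sigmaProd u ^ 2)
      (fun x hx ↦ ?_) (fun l hl x hx ↦ ?_) ?_ ?_ hu hv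
    · have h1 := L.differentiable_weierstrassSigma
      have h2 := (L.analyticOnNhd_weierstrassP x hx).differentiableAt
      have h3 := pow_ne_zero 2 (L.weierstrassSigma_ne_zero hx)
      fun_prop (disch := exact h3)
    · obtain ⟨c, -, hc⟩ := L.exists_weierstrassSigma_add_period hl
      have hs := L.weierstrassSigma_ne_zero hx
      have hs' := L.weierstrassSigma_ne_zero ((add_mem_lattice_iff hl).not.mpr hx)
      have hP : L.weierstrassP (x + l) = L.weierstrassP x := L.weierstrassP_add_coe x ⟨l, hl⟩
      simp only [hq, hP]
      congr 1
      rw [div_eq_div_iff (pow_ne_zero 2 hs') (pow_ne_zero 2 hs)]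
      have e1 : x + l + v = x + v + l := by ring
      have e2 : x + l - v = x - v + l := by ring
      -- The factors exp(ηv) and exp(-ηv) cancel; the remaining multiplier equals that of σ(x)².
      rw [e1, e2, hc, hc, hc, mul_add, mul_sub, Complex.exp_add, Complex.exp_sub]
      have := Complex.exp_ne_zero (L.quasiPeriod l * v)
      field_simp
    · exact hG.div ((L.differentiable_sigmaProd.analyticAt 0).pow 2) (by simp)
    · filter_upwards [nhdsWithin_le_nhds (L.compl_lattice_sdiff_singleton_mem_nhds 0),
        self_mem_nhdsWithin] with x hx1 hx2
      have hx0 : x ≠ 0 := hx2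
      have hx : x ∉ L.lattice := fun h' ↦ hx1 ⟨h', hx0⟩
      have hs := L.sigmaProd_ne_zero hx
      have hP := L.weierstrassPExcept_add 0 x
      simp only [Submodule.coe_zero, sub_zero] at hP
      have hNx := hNG x
      simp only [hN] at hNx
      simp only [hq]
      rw [L.weierstrassSigma_eq x, ← hP, eq_div_iff (pow_ne_zero 2 hs)]
      rw [← mul_right_inj' (pow_ne_zero 2 hx0), ← hNx]
      field_simp
      ring
  rw [hqv] at hquv
  have hs := L.weierstrassSigma_ne_zero hu
  simp only [hq] at hquv
  field_simp at hquv
  linear_combination hquv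

/-! ### Duplication formulas -/

lemma hasDerivAt_weierstrassP {z : ℂ} (hz : z ∉ L.lattice) :
    HasDerivAt L.weierstrassP (L.derivWeierstrassP z) z := by
  rw [← L.deriv_weierstrassP]
  exact (L.analyticOnNhd_weierstrassP z hz).differentiableAt.hasDerivAt

lemma eventually_notMem_lattice {z : ℂ} (hz : z ∉ L.lattice) : ∀ᶠ u in 𝓝 z, u ∉ L.lattice :=
  L.isClosed_lattice.isOpen_compl.mem_nhds hz

/-- Differentiate the product formula in v at v = u, where both σ(u - v) and ℘(v) - ℘(u) vanish. -/
lemma weierstrassSigma_two_mul {u : ℂ} (hu : u ∉ L.lattice) :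
    L.weierstrassSigma (2 * u) = -L.derivWeierstrassP u * L.weierstrassSigma u ^ 4 := by
  have hσ := L.differentiable_weierstrassSigma
  have h1 : HasDerivAt (fun v ↦ L.weierstrassSigma (u + v)) (deriv L.weierstrassSigma (u + u)) u :=
    (hσ (u + u)).hasDerivAt.comp_const_add u u
  have h2 : HasDerivAt (fun v ↦ L.weierstrassSigma (u - v)) (-1) u := by
    refine HasDerivAt.comp_const_sub (f := L.weierstrassSigma) u u ?_
    simpa using L.hasDerivAt_weierstrassSigma_zero
  have h3 := ((hσ u).hasDerivAt.fun_pow 2).const_mul (L.weierstrassSigma u ^ 2)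
  have h4 := (L.hasDerivAt_weierstrassP hu).sub_const (L.weierstrassP u)
  have h5 := (h3.fun_mul h4).unique ((h1.fun_mul h2).congr_of_eventuallyEq
    ((L.eventually_notMem_lattice hu).mono fun v hv ↦ (L.weierstrassSigma_add_mul_sub hu hv).symm))
  simp only [sub_self, weierstrassSigma_zero] at h5
  rw [two_mul]
  linear_combination h5

variable {L} in
lemma notMem_lattice_of_two_mul {u : ℂ} (hu : 2 * u ∉ L.lattice) : u ∉ L.lattice := fun h ↦
  hu (two_mul u ▸ add_mem h h)

lemma derivWeierstrassP_ne_zero {u : ℂ} (hu : 2 * u ∉ L.lattice) : L.derivWeierstrassP u ≠ 0 := by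
  intro h
  have := L.weierstrassSigma_two_mul (notMem_lattice_of_two_mul hu)
  rw [h, neg_zero, zero_mul] at this
  exact L.weierstrassSigma_ne_zero hu this

/-- Differentiate the equation for ℘'² and cancel ℘', which is nonzero when 2u ∉ Ω. -/
lemma hasDerivAt_derivWeierstrassP {u : ℂ} (hu : 2 * u ∉ L.lattice) :
    HasDerivAt L.derivWeierstrassP (6 * L.weierstrassP u ^ 2 - L.g₂ / 2) u := by
  have hu' := notMem_lattice_of_two_mul hu
  have h0 := L.derivWeierstrassP_ne_zero hu
  have hd := (L.analyticOnNhd_derivWeierstrassP u hu').differentiableAt.hasDerivAt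
  have hP := L.hasDerivAt_weierstrassP hu'
  have h1 := (((hP.fun_pow 3).const_mul 4).fun_sub (hP.const_mul L.g₂)).sub_const L.g₃
  have h2 := (hd.fun_pow 2).unique (h1.congr_of_eventuallyEq
    ((L.eventually_notMem_lattice hu').mono fun v hv ↦ L.derivWeierstrassP_sq v hv))
  refine hd.congr_deriv ?_
  rw [← mul_right_inj' h0]
  simp at h2
  linear_combination h2 / 2

/-- Logarithmic derivative of `weierstrassSigma_two_mul`. Two further differentiations give the
duplication formulas for ℘ and ℘'. -/
lemma two_mul_weierstrassZeta_two_mul {u : ℂ} (hu : 2 * u ∉ L.lattice) :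
    2 * L.weierstrassZeta (2 * u) =
      (6 * L.weierstrassP u ^ 2 - L.g₂ / 2) / L.derivWeierstrassP u + 4 * L.weierstrassZeta u := by
  have hu' := notMem_lattice_of_two_mul hu
  have h0 := L.derivWeierstrassP_ne_zero hu
  have hs := L.weierstrassSigma_ne_zero hu'
  have h1 : HasDerivAt (fun u ↦ L.weierstrassSigma (2 * u)) _ u :=
    (L.hasDerivAt_weierstrassSigma hu).comp u ((hasDerivAt_id u).const_mul 2)
  have h2 := (L.hasDerivAt_derivWeierstrassP hu).fun_neg.fun_mul
    ((L.hasDerivAt_weierstrassSigma hu').fun_pow 4)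
  have h3 := h1.unique (h2.congr_of_eventuallyEq
    ((L.eventually_notMem_lattice hu').mono fun v hv ↦ L.weierstrassSigma_two_mul hv))
  rw [L.weierstrassSigma_two_mul hu'] at h3
  simp at h3
  rw [div_add' _ _ _ h0, eq_div_iff h0, ← mul_right_inj' (pow_ne_zero 4 hs)]
  linear_combination -h3

lemma eventually_two_mul_notMem_lattice {u : ℂ} (hu : 2 * u ∉ L.lattice) :
    ∀ᶠ v in 𝓝 u, 2 * v ∉ L.lattice :=
  (continuous_const_mul (2 : ℂ)).continuousAt.eventually (L.eventually_notMem_lattice hu)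

/-- The quotient is ℘''/℘', the slope of the tangent to Y² = 4X³ - g₂X - g₃ at (℘, ℘'). -/
lemma hasDerivAt_slope {u : ℂ} (hu : 2 * u ∉ L.lattice) :
    HasDerivAt (fun u ↦ (6 * L.weierstrassP u ^ 2 - L.g₂ / 2) / L.derivWeierstrassP u)
      (12 * L.weierstrassP u -
        ((6 * L.weierstrassP u ^ 2 - L.g₂ / 2) / L.derivWeierstrassP u) ^ 2) u := by
  have hu' := notMem_lattice_of_two_mul hu
  have h0 := L.derivWeierstrassP_ne_zero hu
  refine (((((L.hasDerivAt_weierstrassP hu').fun_pow 2).const_mul 6).sub_const (L.g₂ / 2)).fun_div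
    (L.hasDerivAt_derivWeierstrassP hu) h0).congr_deriv ?_
  field_simp
  ring

lemma weierstrassP_two_mul {u : ℂ} (hu : 2 * u ∉ L.lattice) :
    L.weierstrassP (2 * u) = -2 * L.weierstrassP u +
      ((6 * L.weierstrassP u ^ 2 - L.g₂ / 2) / L.derivWeierstrassP u) ^ 2 / 4 := by
  have hu' := notMem_lattice_of_two_mul hu
  have h1 : HasDerivAt (fun u ↦ L.weierstrassZeta (2 * u)) _ u :=
    (L.hasDerivAt_weierstrassZeta _ hu).comp u ((hasDerivAt_id u).const_mul 2)
  have h2 := (L.hasDerivAt_slope hu).fun_add ((L.hasDerivAt_weierstrassZeta u hu').const_mul 4)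
  have h3 := (h1.const_mul 2).unique (h2.congr_of_eventuallyEq
    ((L.eventually_two_mul_notMem_lattice hu).mono
      fun v hv ↦ L.two_mul_weierstrassZeta_two_mul hv))
  linear_combination -h3 / 4

lemma derivWeierstrassP_two_mul {u : ℂ} (hu : 2 * u ∉ L.lattice) :
    L.derivWeierstrassP (2 * u) = -L.derivWeierstrassP u +
      (6 * L.weierstrassP u ^ 2 - L.g₂ / 2) / L.derivWeierstrassP u *
        (12 * L.weierstrassP u -
          ((6 * L.weierstrassP u ^ 2 - L.g₂ / 2) / L.derivWeierstrassP u) ^ 2) / 4 := by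
  have hu' := notMem_lattice_of_two_mul hu
  have h1 : HasDerivAt (fun u ↦ L.weierstrassP (2 * u)) _ u :=
    (L.hasDerivAt_weierstrassP hu).comp u ((hasDerivAt_id u).const_mul 2)
  have h2 := ((L.hasDerivAt_weierstrassP hu').const_mul (-2)).fun_add
    (((L.hasDerivAt_slope hu).fun_pow 2).div_const 4)
  have h3 := h1.unique (h2.congr_of_eventuallyEq
    ((L.eventually_two_mul_notMem_lattice hu).mono fun v hv ↦ L.weierstrassP_two_mul hv))
  simp only [Nat.cast_ofNat, Nat.add_one_sub_one, pow_one] at h3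
  linear_combination h3 / 2

/-! ### Division polynomials and the sigma function -/

/-- The function `(-1)^(n+1) σ(nz) / σ(z)^(n²)`. -/
def sigmaQuot (z : ℂ) (n : ℕ) : ℂ :=
  (-1) ^ (n + 1) * L.weierstrassSigma (n * z) / L.weierstrassSigma z ^ n ^ 2

lemma sigmaQuot_zero (z : ℂ) : L.sigmaQuot z 0 = 0 := by
  simp [sigmaQuot]

lemma sigmaQuot_one {z : ℂ} (hz : z ∉ L.lattice) : L.sigmaQuot z 1 = 1 := by
  simp [sigmaQuot, L.weierstrassSigma_ne_zero hz]

lemma sigmaQuot_two {z : ℂ} (hz : z ∉ L.lattice) : L.sigmaQuot z 2 = L.derivWeierstrassP z := by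
  have := L.weierstrassSigma_ne_zero hz
  simp [sigmaQuot, L.weierstrassSigma_two_mul hz]
  field_simp

/-- The product formula at u = (q+d)z, v = qz. The powers of σ(z) match because (2q+d)² + d² =
2(q+d)² + 2q². -/
lemma sigmaQuot_mul {z : ℂ} {q d : ℕ} (hz : z ∉ L.lattice) (hq : q * z ∉ L.lattice)
    (hp : (q + d : ℕ) * z ∉ L.lattice) :
    L.sigmaQuot z (2 * q + d) * L.sigmaQuot z d =
      L.sigmaQuot z (q + d) ^ 2 * L.sigmaQuot z q ^ 2 *
        (L.weierstrassP (q * z) - L.weierstrassP ((q + d : ℕ) * z)) := by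
  have h := L.weierstrassSigma_add_mul_sub hp hq
  have e1 : ((q + d : ℕ) : ℂ) * z + q * z = (2 * q + d : ℕ) * z := by push_cast; ring
  have e2 : ((q + d : ℕ) : ℂ) * z - q * z = d * z := by push_cast; ring
  have hs := L.weierstrassSigma_ne_zero hz
  rw [e1, e2] at h
  have e3 : L.sigmaQuot z (2 * q + d) * L.sigmaQuot z d =
      ((-1) ^ (q + d + 1)) ^ 2 * (L.weierstrassSigma ((2 * q + d : ℕ) * z) *
        L.weierstrassSigma (d * z)) / L.weierstrassSigma z ^ (2 * (q + d) ^ 2 + 2 * q ^ 2) := by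
    have e : 2 * (q + d) ^ 2 + 2 * q ^ 2 = (2 * q + d) ^ 2 + d ^ 2 := by ring
    rw [e, pow_add (L.weierstrassSigma z)]
    simp only [sigmaQuot]
    field_simp
    ring
  rw [e3, h]
  simp only [sigmaQuot]
  rw [pow_add (L.weierstrassSigma z), pow_mul' (L.weierstrassSigma z),
    pow_mul' (L.weierstrassSigma z)]
  have e4 : ((-1 : ℂ) ^ (q + 1)) ^ 2 = 1 := by rw [← pow_mul, mul_comm, pow_mul]; simp
  field_simp
  rw [e4, mul_one]

lemma sigmaQuot_three {z : ℂ} (hz : z ∉ L.lattice) (h2 : 2 * z ∉ L.lattice) :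
    L.sigmaQuot z 3 = 3 * L.weierstrassP z ^ 4 - 3 / 2 * L.g₂ * L.weierstrassP z ^ 2 -
      3 * L.g₃ * L.weierstrassP z - L.g₂ ^ 2 / 16 := by
  have h := L.sigmaQuot_mul (q := 1) (d := 1) hz (by simpa) (by simpa using h2)
  norm_num at h
  have h0 := L.derivWeierstrassP_ne_zero h2
  rw [L.sigmaQuot_one hz, L.sigmaQuot_two hz, L.weierstrassP_two_mul h2] at h
  have hode := L.derivWeierstrassP_sq z hz
  rw [mul_one] at h
  rw [h]
  field_simp
  rw [hode]
  ring

lemma sigmaQuot_four {z : ℂ} (h2 : 2 * z ∉ L.lattice) :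
    L.sigmaQuot z 4 = L.derivWeierstrassP (2 * z) * L.derivWeierstrassP z ^ 4 := by
  have hz := notMem_lattice_of_two_mul h2
  have hs := L.weierstrassSigma_ne_zero hz
  have e : ((4 : ℕ) : ℂ) * z = 2 * (2 * z) := by push_cast; ring
  rw [sigmaQuot, e, L.weierstrassSigma_two_mul h2, L.weierstrassSigma_two_mul hz]
  field_simp
  ring

section Eval

variable {K : Type*} [Field K] [Algebra K ℂ]

lemma aevalAeval_comp_half (x y : ℂ) (p : K[X][Y]) :
    aevalAeval x y (p.comp (C (C (1 / 2)) * X)) = aevalAeval x (y / 2) p := by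
  induction p using Polynomial.induction_on' with
  | add p q hp hq => simp only [add_comp, map_add, hp, hq]
  | monomial n a =>
    rw [← C_mul_X_pow_eq_monomial, mul_comp, C_comp, pow_comp, X_comp]
    simp only [map_mul, map_pow, aevalAeval_C, aevalAeval_Y, aeval_C]
    congr 2
    simp [map_ofNat]
    ring

lemma continuousAt_aevalAeval {f g : ℂ → ℂ} {z : ℂ} (hf : ContinuousAt f z)
    (hg : ContinuousAt g z) (p : K[X][Y]) :
    ContinuousAt (fun u ↦ aevalAeval (f u) (g u) p) z := by
  induction p using Polynomial.induction_on' with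
  | add p q hp hq => simpa only [map_add] using hp.fun_add hq
  | monomial n a =>
    simp only [← C_mul_X_pow_eq_monomial, map_mul, map_pow, aevalAeval_C, aevalAeval_Y]
    exact ((Polynomial.continuous_aeval a).continuousAt.comp hf).mul (hg.pow n)

lemma isAlgebraic_aeval {x : ℂ} (hx : IsAlgebraic K x) (p : K[X]) :
    IsAlgebraic K (aeval x p) := by
  induction p using Polynomial.induction_on' with
  | add p q hp hq => simpa only [map_add] using hp.add hq
  | monomial n a =>
    rw [aeval_monomial]
    exact (isAlgebraic_algebraMap a).mul (hx.pow n)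

lemma isAlgebraic_aevalAeval {x y : ℂ} (hx : IsAlgebraic K x) (hy : IsAlgebraic K y)
    (p : K[X][Y]) : IsAlgebraic K (aevalAeval x y p) := by
  induction p using Polynomial.induction_on' with
  | add p q hp hq => simpa only [map_add] using hp.add hq
  | monomial n a =>
    simp only [← C_mul_X_pow_eq_monomial, map_mul, map_pow, aevalAeval_C, aevalAeval_Y]
    exact (isAlgebraic_aeval hx a).mul (hy.pow n)

end Eval

/-! ### Division polynomials at (℘(z), ℘'(z)/2) -/

/-- Evaluation of a bivariate polynomial at the point `(℘(z), ℘'(z)/2)`. -/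
abbrev evalPoint (z : ℂ) : L.invariantField[X][Y] →ₐ[L.invariantField] ℂ :=
  aevalAeval (L.weierstrassP z) (L.derivWeierstrassP z / 2)

@[simp] lemma coe_g₂K : (L.g₂K : ℂ) = L.g₂ := rfl

@[simp] lemma coe_g₃K : (L.g₃K : ℂ) = L.g₃ := rfl

lemma evalPoint_ψ₂ (z : ℂ) : L.evalPoint z L.curve.ψ₂ = L.derivWeierstrassP z := by
  rw [WeierstrassCurve.ψ₂, WeierstrassCurve.Affine.polynomialY]
  simp only [curve, map_add, map_mul, aevalAeval_C, aevalAeval_Y, map_zero, aeval_C]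
  simp [map_ofNat]
  ring

lemma evalPoint_Ψ₃ (z : ℂ) : L.evalPoint z (C L.curve.Ψ₃) =
    3 * L.weierstrassP z ^ 4 - 3 / 2 * L.g₂ * L.weierstrassP z ^ 2 -
      3 * L.g₃ * L.weierstrassP z - L.g₂ ^ 2 / 16 := by
  rw [evalPoint, aevalAeval_C, WeierstrassCurve.Ψ₃]
  simp [curve, WeierstrassCurve.b₂, WeierstrassCurve.b₄, WeierstrassCurve.b₆, WeierstrassCurve.b₈,
    map_ofNat]
  ring

lemma evalPoint_preΨ₄ {z : ℂ} (h2 : 2 * z ∉ L.lattice) :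
    L.evalPoint z (C L.curve.preΨ₄ * L.curve.ψ₂) =
      L.derivWeierstrassP (2 * z) * L.derivWeierstrassP z ^ 4 := by
  have hode := L.derivWeierstrassP_sq z (notMem_lattice_of_two_mul h2)
  have h0 := L.derivWeierstrassP_ne_zero h2
  rw [L.derivWeierstrassP_two_mul h2, map_mul, evalPoint_ψ₂, evalPoint, aevalAeval_C,
    WeierstrassCurve.preΨ₄]
  simp [curve, WeierstrassCurve.b₂, WeierstrassCurve.b₄, WeierstrassCurve.b₆, WeierstrassCurve.b₈,
    map_ofNat]
  set x := L.weierstrassP z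
  set y := L.derivWeierstrassP z
  have e : (-y + (6 * x ^ 2 - L.g₂ / 2) / y *
      (12 * x - ((6 * x ^ 2 - L.g₂ / 2) / y) ^ 2) / 4) * y ^ 4 =
      (-(y ^ 2) ^ 2 + (6 * x ^ 2 - L.g₂ / 2) *
      (12 * x * y ^ 2 - (6 * x ^ 2 - L.g₂ / 2) ^ 2) / 4) * y := by
    field_simp
  rw [e, hode]
  ring

/-- With every multiple of z off the lattice, `sigmaQuot_mul` holds at all indices needed, and the
recurrences for ψ can be checked by induction. -/
lemma evalPoint_ψ_of_generic {z : ℂ} (hz : ∀ n : ℕ, 1 ≤ n → n * z ∉ L.lattice) (n : ℕ) :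
    L.evalPoint z (L.curve.ψ n) = L.sigmaQuot z n := by
  have hz1 : z ∉ L.lattice := by simpa using hz 1 le_rfl
  have hz2 : 2 * z ∉ L.lattice := by simpa using hz 2 (by norm_num)
  have hmul : ∀ {q : ℕ} (d : ℕ), 1 ≤ q → _ := fun {q} d hq ↦
    L.sigmaQuot_mul (q := q) (d := d) hz1 (hz q hq) (hz (q + d) (by omega))
  have hW1 := L.sigmaQuot_one hz1
  have hW2 := L.sigmaQuot_two hz1
  induction n using normEDSRec with
  | zero => simp [sigmaQuot_zero]
  | one => simp [hW1]
  | two => rw [Nat.cast_ofNat, WeierstrassCurve.ψ_two, evalPoint_ψ₂, hW2]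
  | three =>
    rw [Nat.cast_ofNat, WeierstrassCurve.ψ_three, evalPoint_Ψ₃, L.sigmaQuot_three hz1 hz2]
  | four =>
    rw [Nat.cast_ofNat, WeierstrassCurve.ψ_four, L.evalPoint_preΨ₄ hz2, L.sigmaQuot_four hz2]
  | even m h1 h2 h3 h4 h5 =>
    have h := congrArg (L.evalPoint z) (L.curve.ψ_even (m + 3 : ℕ))
    have e1 : ((m + 3 : ℕ) : ℤ) - 1 = (m + 2 : ℕ) := by push_cast; ring
    have e2 : ((m + 3 : ℕ) : ℤ) - 2 = (m + 1 : ℕ) := by push_cast; ring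
    have e3 : ((m + 3 : ℕ) : ℤ) + 1 = (m + 4 : ℕ) := by push_cast; ring
    have e4 : ((m + 3 : ℕ) : ℤ) + 2 = (m + 5 : ℕ) := by push_cast; ring
    have e5 : 2 * ((m + 3 : ℕ) : ℤ) = (2 * (m + 3) : ℕ) := by push_cast; ring
    rw [e1, e2, e3, e4, e5] at h
    simp only [map_mul, map_sub, map_pow, h1, h2, h3, h4, h5, evalPoint_ψ₂, ← hW2] at h
    -- k2 and k3 involve ℘(z) - ℘((m+4)z) and ℘(z) - ℘((m+2)z). Subtracting suitable multiples
    -- eliminates ℘(z) and leaves the difference in k1. The odd case uses the same elimination.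
    have k1 := hmul (q := m + 2) 2 (by omega)
    have k2 := hmul (q := 1) (m + 3) le_rfl
    have k3 := hmul (q := 1) (m + 1) le_rfl
    rw [show 2 * (m + 2) + 2 = 2 * (m + 3) by ring] at k1
    rw [show 2 * 1 + (m + 3) = m + 5 by ring, show 1 + (m + 3) = m + 4 by ring, hW1] at k2
    rw [show 2 * 1 + (m + 1) = m + 3 by ring, show 1 + (m + 1) = m + 2 by ring, hW1] at k3
    have h0 : L.sigmaQuot z 2 ≠ 0 := hW2 ▸ L.derivWeierstrassP_ne_zero hz2
    refine mul_right_cancel₀ h0 (h.trans ?_)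
    linear_combination L.sigmaQuot z (m + 2) ^ 2 * k2 - L.sigmaQuot z (m + 4) ^ 2 * k3 - k1
  | odd m h1 h2 h3 h4 =>
    have h := congrArg (L.evalPoint z) (L.curve.ψ_odd (m + 2 : ℕ))
    have e1 : ((m + 2 : ℕ) : ℤ) - 1 = (m + 1 : ℕ) := by push_cast; ring
    have e3 : ((m + 2 : ℕ) : ℤ) + 1 = (m + 3 : ℕ) := by push_cast; ring
    have e4 : ((m + 2 : ℕ) : ℤ) + 2 = (m + 4 : ℕ) := by push_cast; ring
    have e5 : 2 * ((m + 2 : ℕ) : ℤ) + 1 = (2 * (m + 2) + 1 : ℕ) := by push_cast; ring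
    rw [e1, e3, e4, e5] at h
    simp only [map_mul, map_sub, map_pow, h1, h2, h3, h4] at h
    have k1 := hmul (q := m + 2) 1 (by omega)
    have k2 := hmul (q := 1) (m + 2) le_rfl
    have k3 := hmul (q := 1) (m + 1) le_rfl
    rw [hW1] at k1
    rw [show 2 * 1 + (m + 2) = m + 4 by ring, show 1 + (m + 2) = m + 3 by ring, hW1] at k2
    rw [show 2 * 1 + (m + 1) = m + 3 by ring, show 1 + (m + 1) = m + 2 by ring, hW1] at k3
    rw [h]
    linear_combination L.sigmaQuot z (m + 2) ^ 2 * k2 - L.sigmaQuot z (m + 3) ^ 2 * k3 - k1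

lemma dense_generic : Dense {z : ℂ | ∀ n : ℕ, 1 ≤ n → n * z ∉ L.lattice} := by
  have hc : (L.lattice : Set ℂ).Countable := countable_of_Lindelof_of_discrete (X := L.lattice)
  have : (⋃ n : ℕ, (fun l : ℂ ↦ l / n) '' L.lattice).Countable :=
    Set.countable_iUnion fun n ↦ hc.image _
  refine (this.dense_compl ℝ).mono ?_
  intro z hz n hn h
  have : (n : ℂ) ≠ 0 := by exact_mod_cast (by omega : n ≠ 0)
  refine hz (Set.mem_iUnion.mpr ⟨n, n * z, h, by field_simp⟩)

/-- The division polynomials in terms of the sigma function. -/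
theorem evalPoint_ψ {z : ℂ} (hz : z ∉ L.lattice) (n : ℕ) :
    L.evalPoint z (L.curve.ψ n) = L.sigmaQuot z n := by
  have hP : ContinuousAt L.weierstrassP z := (L.hasDerivAt_weierstrassP hz).continuousAt
  have hP' : ContinuousAt L.derivWeierstrassP z :=
    (L.analyticOnNhd_derivWeierstrassP z hz).continuousAt
  have hQ : ContinuousAt (fun u ↦ L.sigmaQuot u n) z := by
    have hs := L.continuous_weierstrassSigma
    have h0 := pow_ne_zero (n ^ 2) (L.weierstrassSigma_ne_zero hz)
    unfold sigmaQuot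
    fun_prop (disch := exact h0)
  -- Both sides are continuous at z and agree on the dense set of generic points.
  exact tendsto_nhds_unique_of_frequently_eq
    (continuousAt_aevalAeval hP (hP'.div_const 2) (L.curve.ψ n)) hQ
    ((mem_closure_iff_frequently.mp (L.dense_generic z)).mono
      fun u hu ↦ L.evalPoint_ψ_of_generic hu n)

/-! ### Algebraicity of the division values -/

lemma evalPoint_polynomial {z : ℂ} (hz : z ∉ L.lattice) :
    L.evalPoint z L.curve.toAffine.polynomial = 0 := by
  have hode := L.derivWeierstrassP_sq z hz
  rw [WeierstrassCurve.Affine.polynomial]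
  simp only [curve, map_sub, map_add, map_mul, map_pow, aevalAeval_C, aevalAeval_Y, map_zero,
    aeval_C, aeval_X]
  simp [map_ofNat]
  linear_combination hode / 4

/-- ψ_n² and the univariate `ΨSq n` agree modulo the equation of the curve, which vanishes at the
point. -/
lemma evalPoint_ψ_sq {z : ℂ} (hz : z ∉ L.lattice) (n : ℤ) :
    L.evalPoint z (L.curve.ψ n) ^ 2 = aeval (L.weierstrassP z) (L.curve.ΨSq n) := by
  have h := WeierstrassCurve.Affine.CoordinateRing.mk_Ψ_sq L.curve n
  rw [← WeierstrassCurve.Affine.CoordinateRing.mk_ψ, ← map_pow] at h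
  obtain ⟨q, hq⟩ := AdjoinRoot.mk_eq_mk.mp h
  have h' := congrArg (L.evalPoint z) hq
  rw [map_sub, map_mul, L.evalPoint_polynomial hz, zero_mul, map_pow, evalPoint,
    aevalAeval_C, sub_eq_zero] at h'
  exact h'

/-- The division values of `℘` are algebraic. -/
lemma isAlgebraic_weierstrassP {z : ℂ} (hz : z ∉ L.lattice) {m : ℕ} (hm : m ≠ 0)
    (hmz : m * z ∈ L.lattice) : IsAlgebraic L.invariantField (L.weierstrassP z) := by
  refine ⟨L.curve.ΨSq m, WeierstrassCurve.ΨSq_ne_zero _ (by exact_mod_cast hm), ?_⟩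
  rw [← L.evalPoint_ψ_sq hz, L.evalPoint_ψ hz, sigmaQuot, L.weierstrassSigma_coe hmz]
  simp

lemma isAlgebraic_derivWeierstrassP {z : ℂ} (hz : z ∉ L.lattice)
    (h : IsAlgebraic L.invariantField (L.weierstrassP z)) :
    IsAlgebraic L.invariantField (L.derivWeierstrassP z) := by
  refine IsAlgebraic.of_pow (n := 2) (by norm_num) ?_
  rw [L.derivWeierstrassP_sq z hz]
  have h2 : IsAlgebraic L.invariantField L.g₂ := isAlgebraic_algebraMap L.g₂K
  have h3 : IsAlgebraic L.invariantField L.g₃ := isAlgebraic_algebraMap L.g₃K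
  have h4 : IsAlgebraic L.invariantField (4 : ℂ) := by
    simpa [map_ofNat] using isAlgebraic_algebraMap (A := ℂ) (4 : L.invariantField)
  exact ((h4.mul (h.pow 3)).sub (h2.mul h)).sub h3

end PeriodPair

end

/-! ### The main theorem -/

theorem mainTheorem7 (L : PeriodPair) (ω : ℂ) (hω : ω ∈ L.lattice) (m : ℕ) (hm : 2 ≤ m)
    (hωm : ω / m ∉ L.lattice) :
    (L.divisionPoly (m + 1)).aevalAeval (L.weierstrassP (ω / m)) (L.derivWeierstrassP (ω / m)) ≠ 0 ∧
    (L.weierstrassSigma (ω / m) *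
        Complex.exp (-(L.quasiPeriod ω * ω / (2 * (m : ℂ) ^ 2)))) ^ (m * (m + 2)) =
      L.periodSign ω * (-1) ^ m *
        (1 / (L.divisionPoly (m + 1)).aevalAeval
          (L.weierstrassP (ω / m)) (L.derivWeierstrassP (ω / m))) ∧
    IsAlgebraic L.invariantField
      (L.weierstrassSigma (ω / m) *
        Complex.exp (-(L.quasiPeriod ω * ω / (2 * (m : ℂ) ^ 2)))) := by
  have hm0 : (m : ℂ) ≠ 0 := by exact_mod_cast (by omega : m ≠ 0)
  have hmz : (m : ℂ) * (ω / m) = ω := by field_simp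
  have hs := L.weierstrassSigma_ne_zero hωm
  have hε : L.periodSign ω ^ 2 = 1 := by
    unfold PeriodPair.periodSign
    split_ifs <;> simp
  have hε0 : L.periodSign ω ≠ 0 := fun h ↦ by simp [h] at hε
  set E := Complex.exp (L.quasiPeriod ω * (ω / m + ω / 2)) with hE
  have hE0 : E ≠ 0 := Complex.exp_ne_zero _
  have hψ : (L.divisionPoly (m + 1)).aevalAeval
      (L.weierstrassP (ω / m)) (L.derivWeierstrassP (ω / m)) =
      (-1) ^ m * L.periodSign ω * E / L.weierstrassSigma (ω / m) ^ (m * (m + 2)) := by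
    have h := L.evalPoint_ψ hωm (m + 1)
    have e : ((m + 1 : ℕ) : ℂ) * (ω / m) = ω / m + ω := by
      push_cast
      rw [add_mul, hmz]
      ring
    rw [PeriodPair.divisionPoly, PeriodPair.aevalAeval_comp_half]
    refine h.trans ?_
    rw [PeriodPair.sigmaQuot, e, L.weierstrassSigma_add_period hω,
      ← hE,
      show (m + 1) ^ 2 = m * (m + 2) + 1 by ring]
    field_simp
    ring
  -- The exponents agree since m(m+2)/(2m²) = 1/m + 1/2.
  have hexp : Complex.exp (-(L.quasiPeriod ω * ω / (2 * (m : ℂ) ^ 2))) ^ (m * (m + 2)) = E⁻¹ := by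
    rw [← Complex.exp_nat_mul, hE, ← Complex.exp_neg]
    congr 1
    push_cast
    field_simp
    ring
  have hne : (L.divisionPoly (m + 1)).aevalAeval
      (L.weierstrassP (ω / m)) (L.derivWeierstrassP (ω / m)) ≠ 0 := by
    rw [hψ]
    have : (-1 : ℂ) ^ m ≠ 0 := pow_ne_zero _ (by norm_num)
    positivity
  have hmain : (L.weierstrassSigma (ω / m) *
        Complex.exp (-(L.quasiPeriod ω * ω / (2 * (m : ℂ) ^ 2)))) ^ (m * (m + 2)) =
      L.periodSign ω * (-1) ^ m *
        (1 / (L.divisionPoly (m + 1)).aevalAeval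
          (L.weierstrassP (ω / m)) (L.derivWeierstrassP (ω / m))) := by
    rw [hψ, mul_pow, hexp]
    field_simp
  -- A number with an algebraic positive power is algebraic.
  refine ⟨hne, hmain, IsAlgebraic.of_pow (n := m * (m + 2)) (by positivity) ?_⟩
  have hx := L.isAlgebraic_weierstrassP hωm (m := m) (by omega) (hmz.symm ▸ hω)
  have hy := L.isAlgebraic_derivWeierstrassP hωm hx
  have hεa : IsAlgebraic L.invariantField (L.periodSign ω) := by
    unfold PeriodPair.periodSign
    split_ifs
    · exact isAlgebraic_one
    · exact isAlgebraic_one.neg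
  rw [hmain, one_div]
  exact (hεa.mul (isAlgebraic_one.neg.pow m)).mul
    (PeriodPair.isAlgebraic_aevalAeval hx hy _).inv
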